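/- Let $\lambda=(\lambda_1>\lambda_2>\dots>\lambda_\ell>0)$ be a partition with distinct parts of an integer $n\ge 1$, where $\ell=\ell(\lambda)$ is the number of parts. Let $$[\lambda]^*=\{(i,j)\in\mathbb Z^2 : 1\le i\le \ell,\ i\le j\le \lambda_i+i-1\}$$ be its shifted Young diagram, and let $\mathcal C^*[\lambda]$ be the set of shifted corners, that is, of all $(i,j)\in[\lambda]^*$ with $(i+1,j),(i,j+1)\notin[\lambda]^*$. Let $x,y_1,\dots,y_{\lambda_1+1-\ell}$ be commuting variables, and put $y_j:=x$ for $j\le 0$. For $(i,j)\in[\lambda]^*$ define $$\overline{\mathcal H}^*_{ij}=\begin{cases}(2\ell-2-i-j)\,x+\displaystyle\sum_{t=1}^{\lambda_{j+1}+j-\ell+1}2y_t+\sum_{t=\lambda_{j+1}+j-\ell+2}^{\lambda_i+i-\ell}y_t & \text{if } j<\ell,\\[2ex] \bigl(\max\{k:\lambda_k\ge j+1-k\ge 1\}-i\bigr)\,x+\displaystyle\sum_{t=j+2-\ell}^{\lambda_i+i-\ell}y_t & \text{if } j\ge \ell.\end{cases}$$ Write $$P=\prod_{(i,j)\in[\lambda]^*\setminus\mathcal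 C^*[\lambda]}\overline{\mathcal H}^*_{ij},\qquad Q_{rs}=\prod_{\substack{(i,j)\in[\lambda]^*\setminus\mathcal C^*[\lambda]\\ i\ne r,\ j\ne r-1,\ j\ne s}}\overline{\mathcal H}^*_{ij}.$$ Empty sums are $0$ and empty products are $1$. Then the following three polynomial identities hold: $$\Bigl[\sum_{(p,q)\in[\lambda]^*}x\,y_{q-\ell+1}\Bigr]P=\sum_{(r,s)\in\mathcal C^*[\lambda]}Q_{rs}\prod_{i=1}^{r}(\overline{\mathcal H}^*_{is}+x)\prod_{j=r}^{\ell-1}(\overline{\mathcal H}^*_{rj}+x)\prod_{j=\ell}^{s}(\overline{\mathcal H}^*_{rj}+y_{j-\ell+1})\prod_{i=1}^{r-1}(\overline{\mathcal H}^*_{i,r-1}+x),$$ $$\Bigl[(\ell-1)x+\sum_{j=1}^{\lambda_1+1-\ell}y_j\Bigr]P=\sum_{(r,s)\in\mathcal C^*[\lambda]}Q_{rs}\,D_{rs}\prod_{i=2}^{r}(\overline{\mathcal H}^*_{is}+x)\prod_{j=r}^{\ell-1}(\overline{\mathcal H}^*_{rj}+x)\prod_{j=\ell}^{s}(\overline{\mathcal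 H}^*_{rj}+y_{j-\ell+1})\prod_{i=2}^{r-1}(\overline{\mathcal H}^*_{i,r-1}+x),$$ $$P=\sum_{(r,s)\in\mathcal C^*[\lambda]}Q_{rs}\,E_{rs}\prod_{i=3}^{r}(\overline{\mathcal H}^*_{is}+x)\prod_{j=\max\{r,2\}}^{\ell-1}(\overline{\mathcal H}^*_{rj}+x)\prod_{j=\max\{\ell,2\}}^{s}(\overline{\mathcal H}^*_{rj}+y_{j-\ell+1})\prod_{i=3}^{r-1}(\overline{\mathcal H}^*_{i,r-1}+x),$$ where $$D_{rs}=\begin{cases}\overline{\mathcal H}^*_{1,r-1}+\overline{\mathcal H}^*_{1s}+x & r\ge 2,\\ 1 & r=1,\end{cases}\qquad E_{rs}=\begin{cases}(\overline{\mathcal H}^*_{1s}+x)(\overline{\mathcal H}^*_{2,r-1}+x)+\overline{\mathcal H}^*_{1,r-1}\overline{\mathcal H}^*_{2s} & r\ge 3,\\ \overline{\mathcal H}^*_{1s}+x & r=2,\\ 1 & r=1.\end{cases}$$ -/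

import Mathlib

open Finset BigOperators

namespace ShiftedDiagram

/-- The number of parts `ℓ(λ)`. -/
def len {n : ℕ} (p : Nat.Partition n) : ℕ := p.parts.card

/-- The `i`-th largest part `λ_i`, numbered from `1`; it is `0` for `i > ℓ(λ)`.
(It is used for `i ≥ 1` only.) -/
def part {n : ℕ} (p : Nat.Partition n) (i : ℕ) : ℕ :=
  (p.parts.sort (fun a b => a ≥ b)).getD (i - 1) 0

/-- The shifted diagram `[λ]^*` (for `λ` with distinct parts): all `(i, j)` with
`1 ≤ i ≤ ℓ(λ)` and `i ≤ j ≤ λ_i + i - 1`. -/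
def diagram {n : ℕ} (p : Nat.Partition n) : Finset (ℕ × ℕ) :=
  (Icc 1 (len p)).biUnion fun i => (Icc i (part p i + i - 1)).image fun j => (i, j)

/-- The shifted corners: the squares `(i, j)` such that neither `(i + 1, j)` nor `(i, j + 1)`
is a square. -/
def corners {n : ℕ} (p : Nat.Partition n) : Finset (ℕ × ℕ) :=
  (diagram p).filter fun z => (z.1 + 1, z.2) ∉ diagram p ∧ (z.1, z.2 + 1) ∉ diagram p

/-- `max {k : λ_k ≥ j + 1 - k ≥ 1}`, the number of the last row that meets column `j`
of the shifted diagram. (In `ℕ`, `1 ≤ j + 1 - k` says exactly `k ≤ j`, so the truncated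
subtraction is harmless.) -/
def lastRow {n : ℕ} (p : Nat.Partition n) (j : ℕ) : ℕ :=
  ((Icc 1 (len p)).filter fun k => j + 1 - k ≤ part p k ∧ 1 ≤ j + 1 - k).sup id

variable {R : Type*} [CommRing R]

/-- The weighted punctured hook of the square `(i, j)` of the shifted diagram, with the
variable `x` and the variables `y 1, y 2, …`. For a square of the shifted diagram all
subtractions of natural numbers below have nonnegative results. -/
def wHook {n : ℕ} (p : Nat.Partition n) (x : R) (y : ℕ → R) (i j : ℕ) : R :=
  if j < len p then
    ((2 * len p - 2 - i - j : ℕ) : R) * x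
      + ∑ t ∈ Icc 1 (part p (j + 1) + j + 1 - len p), 2 * y t
      + ∑ t ∈ Icc (part p (j + 1) + j + 2 - len p) (part p i + i - len p), y t
  else
    ((lastRow p j - i : ℕ) : R) * x
      + ∑ t ∈ Icc (j + 2 - len p) (part p i + i - len p), y t

/-- The weight of column `q`: it is `x` for `q < ℓ(λ)` and `y_{q - ℓ(λ) + 1}` for
`q ≥ ℓ(λ)`. -/
def colWeight {n : ℕ} (p : Nat.Partition n) (x : R) (y : ℕ → R) (q : ℕ) : R :=
  if q < len p then x else y (q + 1 - len p)

/-- The product of the weighted punctured hooks of all squares that are not corners. -/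
def hookProd {n : ℕ} (p : Nat.Partition n) (x : R) (y : ℕ → R) : R :=
  ∏ z ∈ diagram p \ corners p, wHook p x y z.1 z.2

/-- The product of the weighted punctured hooks of all squares `(i, j)` that are not corners
and satisfy `i ≠ r`, `j ≠ r - 1` and `j ≠ s`. -/
def restProd {n : ℕ} (p : Nat.Partition n) (x : R) (y : ℕ → R) (r s : ℕ) : R :=
  ∏ z ∈ (diagram p \ corners p).filter (fun z => z.1 ≠ r ∧ z.2 ≠ r - 1 ∧ z.2 ≠ s),
    wHook p x y z.1 z.2

end ShiftedDiagram

/-! Write `X i` for the row weight, that is, `(ℓ - i) x` plus the sum of the `y t` up to the end of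
row `i`. A hook in a column `j < ℓ` equals `X i + X (j + 1) - x`. A hook in a column `j ≥ ℓ` equals
`X i - Z j`, where `Z j` depends only on the column and equals `X r` at the end of a corner row `r`.
The factors involving `y` telescope along the columns (`prod_col`), so the first summand at the
corner of row `r`, divided by `P`, is `x X_r ∏_{i ≠ r} (w_r - a_i) / (w_r - w_i)`, with `w_i = X_i
(X_i - x)` and `a_i = X_i (X_i + x)`. This is `rowCoeff`. It vanishes for a row without a corner,
because then `X_r = X_{r+1} + x` and `w_r = a_{r+1}`, so the sum may run over all rows. Up to the
factor `-2` these are the residues of `∏ (t - a_i) / (t - w_i)`. Their sum gives the first identity,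
the value at the zero `t = a_1` the second, and a combination of the values at `a_1` and `a_2` the
third. The divisions are justified at positive reals, where all denominators in use are nonzero.
Both sides are integer polynomials, so agreement there implies the identity in every commutative
ring. -/

namespace Lagrange

/-! ### Lagrange interpolation for a quotient of monic products. -/

open Polynomial

variable {F ι : Type*} [Field F] {s : Finset ι} {w : ι → F}

/-- The difference of two monic products of the same number of linear factors. -/
theorem degree_nodal_sub_nodal_lt (a w : ι → F) :
    (nodal s a - nodal s w).degree < #s := by
  rw [← degree_nodal (s := s) (v := a)]
  refine degree_sub_lt_left ?_ nodal_ne_zero ?_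
  · rw [degree_nodal, degree_nodal]
  · rw [(nodal_monic (s := s) (v := a)).leadingCoeff, (nodal_monic (s := s) (v := w)).leadingCoeff]

variable [DecidableEq ι]

/-- Both sides are the coefficient of degree `#s - 1` of `∏ (X - a j) - ∏ (X - w j)`. This
polynomial has degree below `#s`, and its value at the node `w i` is `∏ (w i - a j)`. -/
theorem sum_prod_div_prod_erase (hw : Set.InjOn w s) (a : ι → F) :
    ∑ i ∈ s, (∏ j ∈ s, (w i - a j)) / ∏ j ∈ s.erase i, (w i - w j)
      = ∑ i ∈ s, w i - ∑ i ∈ s, a i := by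
  rcases s.eq_empty_or_nonempty with rfl | hs
  · simp
  have h := coeff_eq_sum hw (degree_nodal_sub_nodal_lt a w)
  rw [coeff_sub, nodal_eq, nodal_eq, prod_X_sub_C_coeff_card_pred _ _ hs.card_pos,
    prod_X_sub_C_coeff_card_pred _ _ hs.card_pos] at h
  rw [sub_eq_add_neg, add_comm]
  rw [← sub_neg_eq_add, sub_neg_eq_add, ← sub_neg_eq_add (-∑ i ∈ s, a i), h]
  refine sum_congr rfl fun i hi => ?_
  congr 1
  rw [← nodal_eq, ← nodal_eq, eval_sub, eval_nodal_at_node hi, eval_nodal, sub_zero]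

/-- The interpolation formula for the same difference, evaluated off the nodes and divided by `∏ (t
- w i)`. -/
theorem sum_prod_div_prod_erase_div (hw : Set.InjOn w s) (a : ι → F) {t : F}
    (ht : ∀ i ∈ s, t ≠ w i) :
    ∑ i ∈ s, (∏ j ∈ s, (w i - a j)) / (∏ j ∈ s.erase i, (w i - w j)) / (t - w i)
      = ∏ i ∈ s, (t - a i) / (t - w i) - 1 := by
  rcases s.eq_empty_or_nonempty with rfl | hs
  · simp
  have h := congrArg (eval t) (eq_interpolate hw (degree_nodal_sub_nodal_lt a w))
  have hne := eval_nodal_not_at_node ht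
  rw [eval_interpolate_not_at_node _ ht, eval_sub] at h
  rw [prod_div_distrib, ← eval_nodal, ← eval_nodal]
  have h2 : (eval t (nodal s a) - eval t (nodal s w)) / eval t (nodal s w)
      = eval t (nodal s a) / eval t (nodal s w) - 1 := by
    rw [sub_div, div_self hne]
  rw [← h2, h, mul_div_cancel_left₀ _ hne]
  refine sum_congr rfl fun i hi => ?_
  rw [eval_sub, eval_nodal_at_node hi, eval_nodal, sub_zero, nodalWeight, prod_inv_distrib]
  rw [div_eq_mul_inv, div_eq_mul_inv]
  ring

end Lagrange

/-! ### Row ends and corners of the shifted diagram. -/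

namespace ShiftedDiagram

variable {n : ℕ} {p : Nat.Partition n}

/-- The last column of row `i` of the shifted diagram. -/
def rowEnd (p : Nat.Partition n) (i : ℕ) : ℕ := part p i + i - 1

theorem part_eq_getElem {i : ℕ} (h1 : 1 ≤ i) (h2 : i ≤ len p) :
    part p i = (p.parts.sort (fun a b => a ≥ b))[i - 1]'(by
      rw [Multiset.length_sort]; unfold len at h2; omega) := by
  unfold part
  rw [List.getD_eq_getElem]

theorem part_pos {i : ℕ} (h1 : 1 ≤ i) (h2 : i ≤ len p) : 1 ≤ part p i := by
  rw [part_eq_getElem h1 h2]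
  apply p.parts_pos
  rw [← Multiset.mem_sort (r := fun a b : ℕ => a ≥ b)]
  exact List.getElem_mem _

theorem part_succ_lt (hp : p.parts.Nodup) {i : ℕ} (h1 : 1 ≤ i) (h2 : i < len p) :
    part p (i + 1) < part p i := by
  rw [part_eq_getElem h1 h2.le, part_eq_getElem (by omega) (show i + 1 ≤ len p from h2)]
  have hs := Multiset.pairwise_sort p.parts (fun a b : ℕ => a ≥ b)
  have hn : (p.parts.sort (fun a b : ℕ => a ≥ b)).Nodup := by
    rw [← Multiset.coe_nodup, Multiset.sort_eq]; exact hp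
  unfold len at h2
  have hl : (p.parts.sort (fun a b : ℕ => a ≥ b)).length = p.parts.card :=
    Multiset.length_sort _
  have h3 := List.pairwise_iff_getElem.1 hs (i - 1) (i + 1 - 1) (by omega) (by omega) (by omega)
  have h4 := List.pairwise_iff_getElem.1 hn (i - 1) (i + 1 - 1) (by omega) (by omega) (by omega)
  omega

theorem part_add_eq_rowEnd_succ {i : ℕ} (h1 : 1 ≤ i) :
    part p i + i = rowEnd p i + 1 := by
  unfold rowEnd; omega

theorem rowEnd_succ_le (hp : p.parts.Nodup) {i : ℕ} (h1 : 1 ≤ i) (h2 : i < len p) :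
    rowEnd p (i + 1) ≤ rowEnd p i := by
  have := part_succ_lt hp h1 h2
  unfold rowEnd; omega

theorem rowEnd_anti (hp : p.parts.Nodup) {i k : ℕ} (h1 : 1 ≤ i) (hik : i ≤ k)
    (h2 : k ≤ len p) : rowEnd p k ≤ rowEnd p i := by
  induction k, hik using Nat.le_induction with
  | base => exact le_rfl
  | succ k hk ih =>
    exact (rowEnd_succ_le hp (by omega) (by omega)).trans (ih (by omega))

/-- The last row starts in column `len p` and no row ends before it does. Hence the columns up to
`len p` form a full triangle. -/
theorem len_le_rowEnd (hp : p.parts.Nodup) {i : ℕ} (h1 : 1 ≤ i) (h2 : i ≤ len p) :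
    len p ≤ rowEnd p i := by
  refine le_trans ?_ (rowEnd_anti hp h1 h2 le_rfl)
  have := part_pos (h1.trans h2) (le_refl (len p))
  unfold rowEnd; omega

theorem mem_diagram {i j : ℕ} :
    (i, j) ∈ diagram p ↔ 1 ≤ i ∧ i ≤ len p ∧ i ≤ j ∧ j ≤ rowEnd p i := by
  simp only [diagram, mem_biUnion, mem_Icc, mem_image, Prod.mk.injEq, rowEnd]
  constructor
  · rintro ⟨a, ⟨h1, h2⟩, b, ⟨h3, h4⟩, rfl, rfl⟩
    exact ⟨h1, h2, h3, h4⟩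
  · rintro ⟨h1, h2, h3, h4⟩
    exact ⟨i, ⟨h1, h2⟩, j, ⟨h3, h4⟩, rfl, rfl⟩

/-- Row `r` ends in a shifted corner. -/
def IsCornerRow (p : Nat.Partition n) (r : ℕ) : Prop :=
  r < len p → rowEnd p (r + 1) < rowEnd p r

theorem mem_corners (hp : p.parts.Nodup) {r s : ℕ} :
    (r, s) ∈ corners p ↔ (1 ≤ r ∧ r ≤ len p) ∧ s = rowEnd p r ∧ IsCornerRow p r := by
  simp only [corners, mem_filter, mem_diagram, IsCornerRow]
  constructor
  · rintro ⟨⟨h1, h2, h3, h4⟩, h5, h6⟩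
    have hs : s = rowEnd p r := by
      by_contra hne
      exact h6 ⟨h1, h2, by omega, by omega⟩
    refine ⟨⟨h1, h2⟩, hs, fun hr => ?_⟩
    have := len_le_rowEnd hp h1 h2
    by_contra hle
    exact h5 ⟨by omega, by omega, by omega, by omega⟩
  · rintro ⟨⟨h1, h2⟩, rfl, h4⟩
    have := len_le_rowEnd hp h1 h2
    refine ⟨⟨h1, h2, by omega, le_rfl⟩, ?_, by omega⟩
    rintro ⟨h5, h6, h7, h8⟩
    have := h4 (by omega)
    omega

theorem sum_corners {M : Type*} [AddCommMonoid M] (hp : p.parts.Nodup) (f : ℕ → ℕ → M) :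
    ∑ c ∈ corners p, f c.1 c.2
      = ∑ r ∈ Icc 1 (len p), open Classical in if IsCornerRow p r then f r (rowEnd p r) else 0 := by
  classical
  rw [← sum_filter]
  refine sum_bij' (fun c _ => c.1) (fun r _ => (r, rowEnd p r)) ?_ ?_ ?_ ?_ ?_
  · rintro ⟨r, s⟩ h
    have := (mem_corners hp).1 h
    simp only [mem_filter, mem_Icc]
    exact ⟨this.1, this.2.2⟩
  · intro r h
    simp only [mem_filter, mem_Icc] at h
    exact (mem_corners hp).2 ⟨h.1, rfl, h.2⟩
  · rintro ⟨r, s⟩ h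
    have := (mem_corners hp).1 h
    simp [this.2.1]
  · intro r h
    rfl
  · rintro ⟨r, s⟩ h
    have := (mem_corners hp).1 h
    simp [this.2.1]

theorem sum_diagram {M : Type*} [AddCommMonoid M] (f : ℕ → ℕ → M) :
    ∑ z ∈ diagram p, f z.1 z.2
      = ∑ i ∈ Icc 1 (len p), ∑ j ∈ Icc i (rowEnd p i), f i j := by
  unfold diagram
  rw [sum_biUnion]
  · refine sum_congr rfl fun i _ => ?_
    rw [sum_image (by intro a _ b _ h; simpa using h)]
    rfl
  · intro a _ b _ hab
    simp only [Function.onFun, disjoint_left, mem_image]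
    rintro z ⟨j, _, rfl⟩ ⟨k, _, h⟩
    exact hab (by simpa using (congrArg Prod.fst h).symm)

theorem le_lastRow {i j : ℕ} (h1 : 1 ≤ i) (h2 : i ≤ len p) (h3 : i ≤ j) (h4 : j ≤ rowEnd p i) :
    i ≤ lastRow p j := by
  unfold lastRow
  refine le_sup (f := id) (b := i) ?_
  have := part_add_eq_rowEnd_succ (p := p) h1
  simp only [mem_filter, mem_Icc]
  omega

theorem lastRow_le_len (j : ℕ) : lastRow p j ≤ len p := by
  unfold lastRow
  refine Finset.sup_le fun k hk => ?_
  simp only [mem_filter, mem_Icc] at hk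
  exact hk.1.2

theorem lastRow_eq (hp : p.parts.Nodup) {r j : ℕ} (h1 : 1 ≤ r) (h2 : r ≤ len p) (hj : len p ≤ j)
    (h3 : j ≤ rowEnd p r) (h4 : r < len p → rowEnd p (r + 1) < j) : lastRow p j = r := by
  refine le_antisymm ?_ (le_lastRow h1 h2 (by omega) h3)
  unfold lastRow
  refine Finset.sup_le fun k hk => ?_
  simp only [mem_filter, mem_Icc] at hk
  have h5 := part_add_eq_rowEnd_succ (p := p) hk.1.1
  by_contra hlt
  simp only [id, not_le] at hlt
  have := rowEnd_anti hp (i := r + 1) (k := k) (by omega) hlt hk.1.2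
  have := h4 (by omega)
  omega

end ShiftedDiagram

/-! ### Hooks as sums and differences of row and column values. -/

theorem Finset.sum_Icc_one_add_sum_Icc {M : Type*} [AddCommMonoid M] (f : ℕ → M) {a b : ℕ}
    (h : a ≤ b) : ∑ t ∈ Icc 1 a, f t + ∑ t ∈ Icc (a + 1) b, f t = ∑ t ∈ Icc 1 b, f t := by
  induction b, h using Nat.le_induction with
  | base => simp
  | succ b hb ih =>
    rw [sum_Icc_succ_top (by omega), sum_Icc_succ_top (by omega), ← add_assoc, ih]

namespace ShiftedDiagram

variable {n : ℕ} {p : Nat.Partition n} {R : Type*} [CommRing R] (x : R) (y : ℕ → R)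

/-- The sum of the weights of the columns in row `i`, from the diagonal square on. -/
def rowWeight (p : Nat.Partition n) (x : R) (y : ℕ → R) (i : ℕ) : R :=
  ((len p - i : ℕ) : R) * x + ∑ t ∈ Icc 1 (rowEnd p i + 1 - len p), y t

/-- The quantity whose difference from `rowWeight` is the hook of a square in column
`j ≥ len p`. -/
def colValue (p : Nat.Partition n) (x : R) (y : ℕ → R) (j : ℕ) : R :=
  ((len p - lastRow p j : ℕ) : R) * x + ∑ t ∈ Icc 1 (j + 1 - len p), y t

/-- The `y t` up to the end of row `j + 1` occur in both row weights, whence the coefficient 2. The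
coefficients of `x` in the row weights add up to one more than `2ℓ - 2 - i - j`. -/
theorem wHook_of_lt (hp : p.parts.Nodup) {i j : ℕ} (h1 : 1 ≤ i) (h2 : i ≤ j) (hj : j < len p) :
    wHook p x y i j = rowWeight p x y i + rowWeight p x y (j + 1) - x := by
  have e1 := part_add_eq_rowEnd_succ (p := p) h1
  have e2 := part_add_eq_rowEnd_succ (p := p) (i := j + 1) (by omega)
  have hle := rowEnd_anti hp (i := i) (k := j + 1) h1 (by omega) hj
  have hlen := len_le_rowEnd hp (i := j + 1) (by omega) hj
  have hs := sum_Icc_one_add_sum_Icc y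
    (show rowEnd p (j + 1) + 1 - len p ≤ rowEnd p i + 1 - len p by omega)
  rw [wHook, if_pos hj, show part p (j + 1) + j + 1 - len p = rowEnd p (j + 1) + 1 - len p by omega,
    show part p (j + 1) + j + 2 - len p = rowEnd p (j + 1) + 1 - len p + 1 by omega,
    show part p i + i - len p = rowEnd p i + 1 - len p by omega, rowWeight, rowWeight, ← hs,
    ← mul_sum]
  have hc : ((2 * len p - 2 - i - j : ℕ) : R) + 1 = ((len p - i : ℕ) : R)
      + ((len p - (j + 1) : ℕ) : R) := by
    rw [← Nat.cast_add, ← Nat.cast_succ]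
    congr 1
    omega
  linear_combination x * hc

theorem wHook_of_le {i j : ℕ} (h : (i, j) ∈ diagram p) (hj : len p ≤ j) :
    wHook p x y i j = rowWeight p x y i - colValue p x y j := by
  obtain ⟨h1, h2, h3, h4⟩ := mem_diagram.1 h
  have e1 := part_add_eq_rowEnd_succ (p := p) h1
  have hs := sum_Icc_one_add_sum_Icc y
    (show j + 1 - len p ≤ rowEnd p i + 1 - len p by omega)
  rw [wHook, if_neg (by omega), show j + 2 - len p = j + 1 - len p + 1 by omega,
    show part p i + i - len p = rowEnd p i + 1 - len p by omega, rowWeight, colValue, ← hs]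
  have hl := lastRow_le_len (p := p) j
  have hi := le_lastRow h1 h2 h3 h4
  have hc : ((lastRow p j - i : ℕ) : R) + ((len p - lastRow p j : ℕ) : R)
      = ((len p - i : ℕ) : R) := by
    rw [← Nat.cast_add]
    congr 1
    omega
  linear_combination x * hc

/-- Thus the hook of a corner is zero, which is why `hookProd` omits the corners. -/
theorem colValue_rowEnd (hp : p.parts.Nodup) {r : ℕ} (h1 : 1 ≤ r) (h2 : r ≤ len p)
    (hr : IsCornerRow p r) : colValue p x y (rowEnd p r) = rowWeight p x y r := by
  rw [colValue, rowWeight, lastRow_eq hp h1 h2 (len_le_rowEnd hp h1 h2) le_rfl hr]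

theorem rowWeight_succ_of_eq {r : ℕ} (h2 : r < len p) (h : rowEnd p (r + 1) = rowEnd p r) :
    rowWeight p x y r = rowWeight p x y (r + 1) + x := by
  rw [rowWeight, rowWeight, h, show len p - r = len p - (r + 1) + 1 by omega]
  push_cast
  ring

/-- Subtracting its own `y` from a column value normally gives the value of the preceding column
(`colValue_sub_succ`). The exceptions are the first column, treated here, and the first column past
the end of row `r + 1`, where the last row drops from `r + 1` to `r`. -/
theorem colValue_sub_first (hp : p.parts.Nodup) (hl : 0 < len p) :
    colValue p x y (len p) - y (len p + 1 - len p) = 0 := by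
  rw [colValue, lastRow_eq hp hl le_rfl le_rfl (len_le_rowEnd hp hl le_rfl) (by simp)]
  simp

theorem colValue_sub_rowEnd_succ (hp : p.parts.Nodup) {r : ℕ} (h1 : 1 ≤ r) (h2 : r < len p)
    (hr : rowEnd p (r + 1) < rowEnd p r) :
    colValue p x y (rowEnd p (r + 1) + 1) - y (rowEnd p (r + 1) + 1 + 1 - len p)
      = rowWeight p x y (r + 1) + x := by
  have hlen := len_le_rowEnd hp (i := r + 1) (by omega) h2
  rw [colValue, rowWeight, lastRow_eq hp h1 h2.le (by omega) (by omega) (by omega),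
    show len p - r = len p - (r + 1) + 1 by omega,
    show rowEnd p (r + 1) + 1 + 1 - len p = rowEnd p (r + 1) + 1 - len p + 1 by omega,
    sum_Icc_succ_top (by omega)]
  push_cast
  ring

theorem colValue_sub_succ (hp : p.parts.Nodup) {r j : ℕ} (h1 : 1 ≤ r) (h2 : r ≤ len p)
    (hj : len p ≤ j) (h3 : j < rowEnd p r) (h4 : r < len p → rowEnd p (r + 1) < j) :
    colValue p x y (j + 1) - y (j + 1 + 1 - len p) = colValue p x y j := by
  rw [colValue, colValue, lastRow_eq hp h1 h2 hj h3.le h4,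
    lastRow_eq hp h1 h2 (by omega) h3 (fun h => (h4 h).trans (by omega)),
    show j + 1 + 1 - len p = j + 1 - len p + 1 by omega, sum_Icc_succ_top (by omega)]
  ring

/-! ### Telescoping of the column products. -/

theorem prod_Ico_succ_sub_telescope (v : R) (z z' : ℕ → R) {a b : ℕ} (hab : a ≤ b)
    (h : ∀ j, a ≤ j → j < b → z' (j + 1) = z j) :
    ∏ j ∈ Ico a (b + 1), (v - z' j) = (v - z' a) * ∏ j ∈ Ico a b, (v - z j) := by
  induction b, hab using Nat.le_induction with
  | base => simp
  | succ b hb ih =>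
    rw [prod_Ico_succ_top (by omega), ih fun j h1 h2 => h j h1 (by omega),
      prod_Ico_succ_top (by omega), h b hb (by omega), mul_assoc]

/-- The product over the columns `len p, …, rowEnd p r`, for a row `r` with a corner. -/
theorem prod_col_corner_aux (hp : p.parts.Nodup) (v : R) {r : ℕ} (h1 : 1 ≤ r) (h2 : r ≤ len p)
    (hr : IsCornerRow p r)
    (ih : r < len p →
      (∏ j ∈ Ico (len p) (rowEnd p (r + 1) + 1), (v - (colValue p x y j - y (j + 1 - len p))))
          * ∏ i ∈ Ioc r (len p), (v - rowWeight p x y i)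
        = v * (∏ i ∈ Ioc (r + 1) (len p), (v - rowWeight p x y i - x))
          * ∏ j ∈ Ico (len p) (rowEnd p (r + 1) + 1), (v - colValue p x y j)) :
    (∏ j ∈ Ico (len p) (rowEnd p r + 1), (v - (colValue p x y j - y (j + 1 - len p))))
        * ∏ i ∈ Ioc r (len p), (v - rowWeight p x y i)
      = v * (∏ i ∈ Ioc r (len p), (v - rowWeight p x y i - x))
        * ∏ j ∈ Ico (len p) (rowEnd p r), (v - colValue p x y j) := by
  have hlen := len_le_rowEnd hp h1 h2
  rcases h2.lt_or_eq with hlt | rfl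
  · have hr' := hr hlt
    have hlen' := len_le_rowEnd hp (i := r + 1) (by omega) hlt
    -- The columns are cut at the end of row `r + 1`. The left part is `ih`; the right part
    -- telescopes and leaves the factor `v - (X (r + 1) + x)`.
    rw [← prod_Ico_consecutive _ (show len p ≤ rowEnd p (r + 1) + 1 by omega)
        (show rowEnd p (r + 1) + 1 ≤ rowEnd p r + 1 by omega),
      ← prod_Ico_consecutive _ (show len p ≤ rowEnd p (r + 1) + 1 by omega)
        (show rowEnd p (r + 1) + 1 ≤ rowEnd p r by omega),
      prod_Ico_succ_sub_telescope v (colValue p x y)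
        (fun j => colValue p x y j - y (j + 1 - len p)) (by omega)
        (fun j h3 h4 => colValue_sub_succ x y hp h1 h2 (by omega) h4 (fun _ => by omega)),
      colValue_sub_rowEnd_succ x y hp h1 hlt hr',
      ← prod_Ioc_consecutive (fun i => v - rowWeight p x y i - x) (Nat.le_succ r) hlt, Nat.Ioc_succ_singleton, prod_singleton]
    linear_combination (v - (rowWeight p x y (r + 1) + x))
      * (∏ j ∈ Ico (rowEnd p (r + 1) + 1) (rowEnd p r), (v - colValue p x y j)) * ih hlt
  · rw [prod_Ico_succ_sub_telescope v (colValue p x y)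
        (fun j => colValue p x y j - y (j + 1 - len p)) hlen
        (fun j h3 h4 => colValue_sub_succ x y hp h1 h2 h3 h4 (by simp)),
      colValue_sub_first x y hp h1]
    simp

end ShiftedDiagram

namespace ShiftedDiagram

variable {n : ℕ} {p : Nat.Partition n} {R : Type*} [CommRing R] (x : R) (y : ℕ → R)

theorem not_isCornerRow {r : ℕ} (hp : p.parts.Nodup) (h1 : 1 ≤ r) (h : ¬ IsCornerRow p r) :
    r < len p ∧ rowEnd p (r + 1) = rowEnd p r := by
  simp only [IsCornerRow, Classical.not_imp, not_lt] at h
  exact ⟨h.1, le_antisymm (rowEnd_succ_le hp h1 h.1) h.2⟩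

/-- Downward induction on `r`. A corner row contributes a new telescoping run; a row without a
corner has the same columns as row `r + 1`, and only the factors with `X r = X (r + 1) + x` are
added. -/
theorem prod_col (hp : p.parts.Nodup) (v : R) {r : ℕ} (h1 : 1 ≤ r) (h2 : r ≤ len p) :
    (∏ j ∈ Ico (len p) (rowEnd p r + 1), (v - (colValue p x y j - y (j + 1 - len p))))
        * ∏ i ∈ Ioc (r - 1) (len p), (v - rowWeight p x y i)
      = v * (∏ i ∈ Ioc r (len p), (v - rowWeight p x y i - x))
        * ∏ j ∈ Ico (len p) (rowEnd p r + 1), (v - colValue p x y j) := by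
  induction hd : len p - r generalizing r with
  | zero =>
    have aux := prod_col_corner_aux x y hp v h1 h2 (fun h => by omega) (fun h => by omega)
    rw [← prod_Ioc_consecutive (fun i => v - rowWeight p x y i) (Nat.sub_le r 1) h2,
      prod_Ico_succ_top (len_le_rowEnd hp h1 h2) (fun j => v - colValue p x y j),
      colValue_rowEnd x y hp h1 h2 (fun h => by omega)]
    have : Ioc (r - 1) r = {r} := by ext; simp only [mem_Ioc, mem_singleton]; omega
    rw [this, prod_singleton]
    linear_combination (v - rowWeight p x y r) * aux
  | succ d ih =>
    have ih' := ih (r := r + 1) (by omega) (by omega) (by omega)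
    rw [Nat.add_sub_cancel] at ih'
    rw [← prod_Ioc_consecutive (fun i => v - rowWeight p x y i) (Nat.sub_le r 1) h2]
    have : Ioc (r - 1) r = {r} := by ext; simp only [mem_Ioc, mem_singleton]; omega
    rw [this, prod_singleton]
    by_cases hr : IsCornerRow p r
    · have aux := prod_col_corner_aux x y hp v h1 h2 hr (fun _ => ih')
      rw [prod_Ico_succ_top (len_le_rowEnd hp h1 h2) (fun j => v - colValue p x y j),
        colValue_rowEnd x y hp h1 h2 hr]
      linear_combination (v - rowWeight p x y r) * aux
    · obtain ⟨hlt, he⟩ := not_isCornerRow hp h1 hr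
      rw [he] at ih'
      rw [← prod_Ioc_consecutive (fun i => v - rowWeight p x y i - x) (Nat.le_succ r) hlt,
        Nat.Ioc_succ_singleton, prod_singleton, rowWeight_succ_of_eq x y hlt he]
      linear_combination (v - (rowWeight p x y (r + 1) + x)) * ih'

/-- Here the factor `v - X r` is absent from both sides. It cannot be cancelled from `prod_col`
afterwards, since the identity is used at `v = X r`. -/
theorem prod_col_corner (hp : p.parts.Nodup) (v : R) {r : ℕ} (h1 : 1 ≤ r) (h2 : r ≤ len p)
    (hr : IsCornerRow p r) :
    (∏ j ∈ Ico (len p) (rowEnd p r + 1), (v - (colValue p x y j - y (j + 1 - len p))))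
        * ∏ i ∈ Ioc r (len p), (v - rowWeight p x y i)
      = v * (∏ i ∈ Ioc r (len p), (v - rowWeight p x y i - x))
        * ∏ j ∈ Ico (len p) (rowEnd p r), (v - colValue p x y j) :=
  prod_col_corner_aux x y hp v h1 h2 hr
    fun h => by simpa using prod_col x y hp v (r := r + 1) (by omega) h

/-! ### Factoring the hook product and the first summand at a corner. -/

/-- The product of all hooks splits off those in the row of a corner `(r, rowEnd p r)`, in its
column, and in column `r - 1`. -/
theorem hookProd_eq_restProd_mul (hp : p.parts.Nodup) {r : ℕ} (h1 : 1 ≤ r) (h2 : r ≤ len p)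
    (hr : IsCornerRow p r) :
    hookProd p x y = restProd p x y r (rowEnd p r)
      * ((∏ j ∈ Ico r (rowEnd p r), wHook p x y r j)
        * (∏ i ∈ Ico 1 r, wHook p x y i (rowEnd p r))
        * ∏ i ∈ Ico 1 r, wHook p x y i (r - 1)) := by
  have hlen := len_le_rowEnd hp h1 h2
  rw [hookProd, restProd, ← prod_filter_mul_prod_filter_not (diagram p \ corners p)
    (fun z => z.1 ≠ r ∧ z.2 ≠ r - 1 ∧ z.2 ≠ rowEnd p r)]
  congr 1
  -- Column `rowEnd p r` has no square below row `r` because `r` is a corner row, and column `r - 1`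
  -- lies entirely above row `r`. For `r = 1` both column pieces are empty.
  have hset : (diagram p \ corners p).filter
      (fun z => ¬ (z.1 ≠ r ∧ z.2 ≠ r - 1 ∧ z.2 ≠ rowEnd p r))
      = ((Ico r (rowEnd p r)).image (fun j => (r, j))
        ∪ (Ico 1 r).image (fun i => (i, rowEnd p r))) ∪ (Ico 1 r).image (fun i => (i, r - 1)) := by
    ext ⟨i, j⟩
    simp only [mem_filter, mem_sdiff, mem_diagram, mem_corners hp, mem_union, mem_image, mem_Ico,
      Prod.mk.injEq]
    constructor
    · rintro ⟨⟨⟨a1, a2, a3, a4⟩, a5⟩, a6⟩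
      by_cases hir : i = r
      · subst hir
        refine Or.inl (Or.inl ⟨j, ⟨a3, lt_of_le_of_ne a4 fun h => a5 ⟨⟨a1, a2⟩, h, hr⟩⟩, rfl, rfl⟩)
      · by_cases hj : j = r - 1
        · exact Or.inr ⟨i, by omega, rfl, hj.symm⟩
        · have hj2 : j = rowEnd p r := by
            by_contra h
            exact a6 ⟨hir, hj, h⟩
          refine Or.inl (Or.inr ⟨i, ⟨a1, ?_⟩, rfl, hj2.symm⟩)
          by_contra hlt
          have h3 := rowEnd_anti hp (i := r + 1) (k := i) (by omega) (by omega) a2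
          have h4 := hr (by omega)
          omega
    · rintro ((⟨k, hk, rfl, rfl⟩ | ⟨k, hk, rfl, rfl⟩) | ⟨k, hk, rfl, rfl⟩)
      · exact ⟨⟨⟨h1, h2, hk.1, hk.2.le⟩, by omega⟩, by simp⟩
      · have h3 := rowEnd_anti hp (i := k) (k := r) (by omega) (by omega) h2
        refine ⟨⟨⟨hk.1, by omega, by omega, h3⟩, ?_⟩, by simp⟩
        rintro ⟨-, h5, h6⟩
        have h7 := h6 (by omega)
        have h8 := rowEnd_anti hp (i := k + 1) (k := r) (by omega) (by omega) h2
        omega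
      · have h3 := rowEnd_anti hp (i := k) (k := r) (by omega) (by omega) h2
        exact ⟨⟨⟨hk.1, by omega, by omega, by omega⟩, by omega⟩, by simp⟩
  rw [hset, prod_union, prod_union, prod_image, prod_image, prod_image]
  · intro a _ b _ h; simpa using h
  · intro a _ b _ h; simpa using h
  · intro a _ b _ h; simpa using h
  · simp only [disjoint_left, mem_image, mem_Ico]
    rintro z ⟨j, hj, rfl⟩ ⟨k, hk, h⟩
    simp only [Prod.mk.injEq] at h
    omega
  · simp only [disjoint_left, mem_image, mem_Ico, mem_union]
    rintro z (⟨j, hj, rfl⟩ | ⟨j, hj, rfl⟩) ⟨k, hk, h⟩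
    all_goals
      simp only [Prod.mk.injEq] at h
      omega

theorem wHook_col_corner (hp : p.parts.Nodup) {r i : ℕ} (hi : 1 ≤ i) (hir : i ≤ r)
    (h2 : r ≤ len p) (hr : IsCornerRow p r) :
    wHook p x y i (rowEnd p r) = rowWeight p x y i - rowWeight p x y r := by
  have hlen := len_le_rowEnd hp (hi.trans hir) h2
  rw [wHook_of_le x y (mem_diagram.2 ⟨hi, by omega, by omega, rowEnd_anti hp hi hir h2⟩) hlen,
    colValue_rowEnd x y hp (by omega) h2 hr]

theorem wHook_col_pred (hp : p.parts.Nodup) {r i : ℕ} (hi : 1 ≤ i) (hir : i < r)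
    (h2 : r ≤ len p) :
    wHook p x y i (r - 1) = rowWeight p x y i + rowWeight p x y r - x := by
  rw [wHook_of_lt x y hp hi (by omega) (by omega), show r - 1 + 1 = r by omega]

theorem prod_row_lt (hp : p.parts.Nodup) (c : R) {r a : ℕ} (h1 : 1 ≤ r) (ha : r ≤ a) :
    ∏ j ∈ Ico a (len p), (wHook p x y r j + c)
      = ∏ i ∈ Ioc a (len p), (rowWeight p x y r + rowWeight p x y i - x + c) := by
  rw [show Ioc a (len p) = Ico (a + 1) (len p + 1) by ext; simp only [mem_Ico, mem_Ioc]; omega,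
    ← prod_Ico_add' (fun i => rowWeight p x y r + rowWeight p x y i - x + c) a (len p) 1]
  refine prod_congr rfl fun j hj => ?_
  rw [mem_Ico] at hj
  rw [wHook_of_lt x y hp h1 (by omega) hj.2]

theorem hookProd_eq (hp : p.parts.Nodup) {r : ℕ} (h1 : 1 ≤ r) (h2 : r ≤ len p)
    (hr : IsCornerRow p r) :
    hookProd p x y = restProd p x y r (rowEnd p r)
      * (((∏ i ∈ Ioc r (len p), (rowWeight p x y r + rowWeight p x y i - x))
          * ∏ j ∈ Ico (len p) (rowEnd p r), (rowWeight p x y r - colValue p x y j))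
        * (∏ i ∈ Ico 1 r, (rowWeight p x y i - rowWeight p x y r))
        * ∏ i ∈ Ico 1 r, (rowWeight p x y i + rowWeight p x y r - x)) := by
  have hlen := len_le_rowEnd hp h1 h2
  rw [hookProd_eq_restProd_mul x y hp h1 h2 hr, ← prod_Ico_consecutive _ h2 hlen]
  have e0 := prod_row_lt x y hp 0 h1 le_rfl
  simp only [add_zero] at e0
  rw [e0, prod_congr rfl fun j hj => wHook_of_le x y
      (mem_diagram.2 ⟨h1, h2, h2.trans (mem_Ico.1 hj).1, (mem_Ico.1 hj).2.le⟩) (mem_Ico.1 hj).1,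
    prod_congr rfl fun i hi => wHook_col_corner x y hp (mem_Ico.1 hi).1 (mem_Ico.1 hi).2.le h2 hr,
    prod_congr rfl fun i hi => wHook_col_pred x y hp (mem_Ico.1 hi).1 (mem_Ico.1 hi).2 h2]

/-- The summand of the first identity. -/
def firstTerm (p : Nat.Partition n) (x : R) (y : ℕ → R) (r s : ℕ) : R :=
  restProd p x y r s
    * (∏ i ∈ Icc 1 r, (wHook p x y i s + x))
    * (∏ j ∈ Icc r (len p - 1), (wHook p x y r j + x))
    * (∏ j ∈ Icc (len p) s, (wHook p x y r j + y (j + 1 - len p)))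
    * (∏ i ∈ Icc 1 (r - 1), (wHook p x y i (r - 1) + x))

/-- The summand of the second identity. -/
def secondTerm (p : Nat.Partition n) (x : R) (y : ℕ → R) (r s : ℕ) : R :=
  restProd p x y r s
    * (if 2 ≤ r then wHook p x y 1 (r - 1) + wHook p x y 1 s + x else 1)
    * (∏ i ∈ Icc 2 r, (wHook p x y i s + x))
    * (∏ j ∈ Icc r (len p - 1), (wHook p x y r j + x))
    * (∏ j ∈ Icc (len p) s, (wHook p x y r j + y (j + 1 - len p)))
    * (∏ i ∈ Icc 2 (r - 1), (wHook p x y i (r - 1) + x))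

/-- The summand of the third identity. -/
def thirdTerm (p : Nat.Partition n) (x : R) (y : ℕ → R) (r s : ℕ) : R :=
  restProd p x y r s
    * (if 3 ≤ r then (wHook p x y 1 s + x) * (wHook p x y 2 (r - 1) + x)
          + wHook p x y 1 (r - 1) * wHook p x y 2 s
        else if r = 2 then wHook p x y 1 s + x else 1)
    * (∏ i ∈ Icc 3 r, (wHook p x y i s + x))
    * (∏ j ∈ Icc (max r 2) (len p - 1), (wHook p x y r j + x))
    * (∏ j ∈ Icc (max (len p) 2) s, (wHook p x y r j + y (j + 1 - len p)))
    * (∏ i ∈ Icc 3 (r - 1), (wHook p x y i (r - 1) + x))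

theorem prod_row_ge {r a : ℕ} (h1 : 1 ≤ r) (h2 : r ≤ len p) (ha : len p ≤ a) :
    ∏ j ∈ Icc a (rowEnd p r), (wHook p x y r j + y (j + 1 - len p))
      = ∏ j ∈ Ico a (rowEnd p r + 1),
          (rowWeight p x y r - (colValue p x y j - y (j + 1 - len p))) := by
  rw [show Ico a (rowEnd p r + 1) = Icc a (rowEnd p r) by ext; simp only [mem_Ico, mem_Icc]; omega]
  refine prod_congr rfl fun j hj => ?_
  rw [mem_Icc] at hj
  rw [wHook_of_le x y (mem_diagram.2 ⟨h1, h2, by omega, hj.2⟩) (by omega)]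
  ring

theorem prod_Icc_one_eq (f : ℕ → R) {r : ℕ} (h1 : 1 ≤ r) :
    ∏ i ∈ Icc 1 r, f i = (∏ i ∈ Ico 1 r, f i) * f r := by
  rw [show Icc 1 r = Ico 1 (r + 1) by ext; simp only [mem_Ico, mem_Icc]; omega, prod_Ico_succ_top h1]

theorem firstTerm_eq (hp : p.parts.Nodup) {r : ℕ} (h1 : 1 ≤ r) (h2 : r ≤ len p)
    (hr : IsCornerRow p r) :
    firstTerm p x y r (rowEnd p r) = restProd p x y r (rowEnd p r)
      * ((∏ i ∈ Ico 1 r, (rowWeight p x y i - rowWeight p x y r + x)) * x)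
      * (∏ i ∈ Ioc r (len p), (rowWeight p x y r + rowWeight p x y i))
      * (∏ j ∈ Ico (len p) (rowEnd p r + 1),
          (rowWeight p x y r - (colValue p x y j - y (j + 1 - len p))))
      * ∏ i ∈ Ico 1 r, (rowWeight p x y i + rowWeight p x y r) := by
  have e0 := prod_row_lt x y hp x h1 le_rfl
  simp only [sub_add_cancel] at e0
  rw [firstTerm, prod_row_ge x y h1 h2 le_rfl, prod_Icc_one_eq _ h1, ← e0,
    wHook_col_corner x y hp h1 le_rfl h2 hr, sub_self, zero_add,
    show Icc r (len p - 1) = Ico r (len p) by ext; simp only [mem_Ico, mem_Icc]; omega,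
    show Icc 1 (r - 1) = Ico 1 r by ext; simp only [mem_Ico, mem_Icc]; omega,
    prod_congr rfl fun i hi => congrArg (· + x)
      (wHook_col_corner x y hp (mem_Ico.1 hi).1 (mem_Ico.1 hi).2.le h2 hr),
    prod_congr rfl fun i hi => congrArg (· + x)
      (wHook_col_pred x y hp (mem_Ico.1 hi).1 (mem_Ico.1 hi).2 h2)]
  simp only [sub_add_cancel]

end ShiftedDiagram

/-! ### Partial fractions with nodes `X i * (X i - x)`. -/

namespace ShiftedDiagram

/-- The coefficient of row `r` in the partial fraction expansion of
`∏ (t - X i * (X i + x)) / (t - X i * (X i - x))`, up to the factor `-2`. -/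
def rowCoeff {K : Type*} [Field K] (L : ℕ) (x : K) (X : ℕ → K) (r : ℕ) : K :=
  x * X r * ∏ i ∈ (Icc 1 L).erase r,
    (X r * (X r - x) - X i * (X i + x)) / (X r * (X r - x) - X i * (X i - x))

section RowCoeff

variable {K : Type*} [Field K] {L : ℕ} {x : K} {X : ℕ → K}

/-- The factor `i = r` of the full numerator is `X r * (X r - x) - X r * (X r + x) = -2 x X r`. -/
theorem two_mul_rowCoeff {r : ℕ} (hr : r ∈ Icc 1 L) :
    2 * rowCoeff L x X r
      = -((∏ i ∈ Icc 1 L, (X r * (X r - x) - X i * (X i + x)))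
        / ∏ i ∈ (Icc 1 L).erase r, (X r * (X r - x) - X i * (X i - x))) := by
  rw [rowCoeff, prod_div_distrib, ← mul_prod_erase _ _ hr]
  ring

theorem rowCoeff_eq_zero {r i : ℕ} (hi : i ∈ Icc 1 L) (hir : i ≠ r) (h : X r = X i + x) :
    rowCoeff L x X r = 0 := by
  rw [rowCoeff, prod_eq_zero (mem_erase.2 ⟨hir, hi⟩), mul_zero]
  rw [h, div_eq_zero_iff]
  left
  ring

theorem two_mul_sum_rowCoeff
    (hX : Set.InjOn (fun i => X i * (X i - x)) (Icc 1 L)) :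
    2 * ∑ r ∈ Icc 1 L, rowCoeff L x X r = 2 * (x * ∑ r ∈ Icc 1 L, X r) := by
  have h := Lagrange.sum_prod_div_prod_erase hX (fun i => X i * (X i + x))
  rw [mul_sum, sum_congr rfl fun r hr => two_mul_rowCoeff hr, sum_neg_distrib, h, neg_sub,
    ← sum_sub_distrib, ← mul_assoc, mul_sum]
  exact sum_congr rfl fun r _ => by ring

/-- The evaluation point is a zero of the numerator `∏ (t - X i * (X i + x))`, so only the `-1` of
the interpolation formula survives. -/
theorem sum_two_mul_rowCoeff_div
    (hX : Set.InjOn (fun i => X i * (X i - x)) (Icc 1 L)) {k : ℕ} (hk : k ∈ Icc 1 L)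
    (ht : ∀ i ∈ Icc 1 L, X k * (X k + x) ≠ X i * (X i - x)) :
    ∑ r ∈ Icc 1 L, 2 * rowCoeff L x X r / (X k * (X k + x) - X r * (X r - x)) = 1 := by
  have h := Lagrange.sum_prod_div_prod_erase_div hX (fun i => X i * (X i + x)) ht
  rw [sum_congr rfl fun r hr => by rw [two_mul_rowCoeff hr, neg_div], sum_neg_distrib, h,
    prod_eq_zero hk (by simp)]
  ring

end RowCoeff

section Ordered

variable {L : ℕ} {x : ℝ} {X : ℕ → ℝ}

theorem injOn_mul_sub (hx : 0 < x) (hpos : ∀ i ∈ Icc 1 L, 0 < X i)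
    (hgap : ∀ i ∈ Icc 1 L, ∀ k ∈ Icc 1 L, i < k → X k + x ≤ X i) :
    Set.InjOn (fun i => X i * (X i - x)) (Icc 1 L) := by
  have key : ∀ i ∈ Icc 1 L, ∀ k ∈ Icc 1 L, i < k → X k * (X k - x) < X i * (X i - x) := by
    intro i hi k hk hik
    have h1 := hgap i hi k hk hik
    have h2 := hpos k hk
    have : 0 < (X i - X k) * (X i + X k - x) := mul_pos (by linarith) (by linarith)
    linarith
  intro i hi k hk h
  rcases lt_trichotomy i k with hik | rfl | hik
  · exact absurd h (key i hi k hk hik).ne'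
  · rfl
  · exact absurd h (key k hk i hi hik).ne

theorem sub_pos_of_le (hx : 0 < x) (hpos : ∀ i ∈ Icc 1 L, 0 < X i)
    (hgap : ∀ i ∈ Icc 1 L, ∀ k ∈ Icc 1 L, i < k → X k + x ≤ X i) {i r : ℕ} (hi : i ∈ Icc 1 L)
    (hr : r ∈ Icc 1 L) (hir : i ≤ r) : 0 < X i * (X i + x) - X r * (X r - x) := by
  have h1 := hpos i hi
  have h2 := hpos r hr
  have h3 : X r ≤ X i := by
    rcases hir.lt_or_eq with h | rfl
    · linarith [hgap i hi r hr h]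
    · exact le_rfl
  have : 0 < (X i + X r) * (X i - X r + x) := mul_pos (by linarith) (by linarith)
  linarith

theorem sum_rowCoeff_eq (hx : 0 < x) (hpos : ∀ i ∈ Icc 1 L, 0 < X i)
    (hgap : ∀ i ∈ Icc 1 L, ∀ k ∈ Icc 1 L, i < k → X k + x ≤ X i) :
    ∑ r ∈ Icc 1 L, rowCoeff L x X r = x * ∑ r ∈ Icc 1 L, X r :=
  mul_left_cancel₀ two_ne_zero (two_mul_sum_rowCoeff (injOn_mul_sub hx hpos hgap))

theorem sum_rowCoeff_div_first (hL : 1 ≤ L) (hx : 0 < x) (hpos : ∀ i ∈ Icc 1 L, 0 < X i)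
    (hgap : ∀ i ∈ Icc 1 L, ∀ k ∈ Icc 1 L, i < k → X k + x ≤ X i) :
    ∑ r ∈ Icc 1 L, 2 * rowCoeff L x X r / (X 1 * (X 1 + x) - X r * (X r - x)) = 1 := by
  have h1 : 1 ∈ Icc 1 L := mem_Icc.2 ⟨le_rfl, hL⟩
  refine sum_two_mul_rowCoeff_div (injOn_mul_sub hx hpos hgap) h1 fun i hi => ?_
  exact sub_ne_zero.1 (sub_pos_of_le hx hpos hgap h1 hi (mem_Icc.1 hi).1).ne'

/-- With `a_k = X k * (X k + x)`, the summand splits by partial fractions into the sums for `a_1`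
and `a_2`; the two weights add up to 1. -/
theorem sum_rowCoeff_div_first_second (hL : 2 ≤ L) (hx : 0 < x) (hpos : ∀ i ∈ Icc 1 L, 0 < X i)
    (hgap : ∀ i ∈ Icc 1 L, ∀ k ∈ Icc 1 L, i < k → X k + x ≤ X i) :
    ∑ r ∈ Icc 1 L, 2 * rowCoeff L x X r * (X 1 * X 2 - X r * (X r - x))
      / ((X 1 * (X 1 + x) - X r * (X r - x)) * (X 2 * (X 2 + x) - X r * (X r - x))) = 1 := by
  have m1 : 1 ∈ Icc 1 L := mem_Icc.2 ⟨le_rfl, by omega⟩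
  have m2 : 2 ∈ Icc 1 L := mem_Icc.2 ⟨by omega, hL⟩
  have h12 := hgap 1 m1 2 m2 (by omega)
  have p1 := hpos 1 m1
  have p2 := hpos 2 m2
  have s1 := sum_rowCoeff_div_first (by omega) hx hpos hgap
  have d1 : ∀ r ∈ Icc 1 L, X 1 * (X 1 + x) - X r * (X r - x) ≠ 0 := fun r hr =>
    (sub_pos_of_le hx hpos hgap m1 hr (mem_Icc.1 hr).1).ne'
  have d2 : ∀ r ∈ Icc 1 L, 2 ≤ r → X 2 * (X 2 + x) - X r * (X r - x) ≠ 0 := fun r hr h =>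
    (sub_pos_of_le hx hpos hgap m2 hr h).ne'
  rcases h12.lt_or_eq with hlt | heq
  · have d2' : ∀ r ∈ Icc 1 L, X 2 * (X 2 + x) - X r * (X r - x) ≠ 0 := by
      intro r hr
      rcases (mem_Icc.1 hr).1.lt_or_eq with h | rfl
      · exact d2 r hr h
      · have : (X 2 + X 1) * (X 2 - X 1 + x) < 0 :=
          mul_neg_of_pos_of_neg (by linarith) (by linarith)
        refine ne_of_lt ?_
        linarith
    have s2 := sum_two_mul_rowCoeff_div (injOn_mul_sub hx hpos hgap) m2
      fun r hr => sub_ne_zero.1 (d2' r hr)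
    have hc : (X 1 - X 2) * (X 1 + X 2 + x) ≠ 0 :=
      mul_ne_zero (by linarith) (by linarith)
    have key : ∀ r ∈ Icc 1 L, 2 * rowCoeff L x X r * (X 1 * X 2 - X r * (X r - x))
        / ((X 1 * (X 1 + x) - X r * (X r - x)) * (X 2 * (X 2 + x) - X r * (X r - x)))
        = X 1 * (X 1 - X 2 + x) / ((X 1 - X 2) * (X 1 + X 2 + x))
            * (2 * rowCoeff L x X r / (X 1 * (X 1 + x) - X r * (X r - x)))
          + X 2 * (X 1 - X 2 - x) / ((X 1 - X 2) * (X 1 + X 2 + x))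
            * (2 * rowCoeff L x X r / (X 2 * (X 2 + x) - X r * (X r - x))) := by
      intro r hr
      have := d1 r hr
      have := d2' r hr
      rw [div_mul_div_comm, div_mul_div_comm, div_add_div _ _ (mul_ne_zero hc ‹_›)
        (mul_ne_zero hc ‹_›), div_eq_div_iff (mul_ne_zero ‹_› ‹_›)
        (mul_ne_zero (mul_ne_zero hc ‹_›) (mul_ne_zero hc ‹_›))]
      ring
    rw [sum_congr rfl key, sum_add_distrib, ← mul_sum, ← mul_sum, s1, s2, mul_one, mul_one,
      ← add_div, div_eq_one_iff_eq hc]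
    ring
  -- Now `a_2` is the node of row 1, so the sum for `a_2` is unavailable. But `X 1 * X 2 = a_2`
  -- cancels that denominator for `r ≥ 2`, and the coefficient of row 1 vanishes.
  · rw [← s1]
    refine sum_congr rfl fun r hr => ?_
    rcases (mem_Icc.1 hr).1.lt_or_eq with h | rfl
    · rw [show X 1 * X 2 = X 2 * (X 2 + x) by rw [heq]; ring,
        mul_div_mul_right _ _ (d2 r hr h)]
    · rw [rowCoeff_eq_zero m2 (by omega) heq.symm]
      simp

end Ordered

end ShiftedDiagram

/-! ### Ratios between the three summands. -/

namespace ShiftedDiagram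

variable {n : ℕ} {p : Nat.Partition n}

section Ring

variable {R : Type*} [CommRing R] (x : R) (y : ℕ → R)

theorem prod_Icc_eq_mul_prod_Icc_succ (f : ℕ → R) {a b : ℕ} (h : a ≤ b) :
    ∏ i ∈ Icc a b, f i = f a * ∏ i ∈ Icc (a + 1) b, f i := by
  rw [← insert_Icc_add_one_left_eq_Icc h, prod_insert (by simp)]

theorem sum_colWeight_row (hp : p.parts.Nodup) {i : ℕ} (h1 : 1 ≤ i) (h2 : i ≤ len p) :
    ∑ j ∈ Icc i (rowEnd p i), colWeight p x y j = rowWeight p x y i := by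
  have hlen := len_le_rowEnd hp h1 h2
  rw [show Icc i (rowEnd p i) = Ico i (rowEnd p i + 1) by ext; simp only [mem_Ico, mem_Icc]; omega,
    ← sum_Ico_consecutive _ h2 (show len p ≤ rowEnd p i + 1 by omega), rowWeight]
  congr 1
  · refine (sum_congr rfl fun j hj => if_pos (mem_Ico.1 hj).2).trans ?_
    simp
  · refine (sum_congr rfl fun j hj => if_neg (mem_Ico.1 hj).1.not_gt).trans ?_
    rw [show Icc 1 (rowEnd p i + 1 - len p) = Ico (0 + 1) (rowEnd p i + 1 - len p + 1) by
        ext; simp only [mem_Ico, mem_Icc]; omega,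
      ← sum_Ico_add' y 0 (rowEnd p i + 1 - len p) 1, sum_Ico_eq_sum_range, sum_Ico_eq_sum_range]
    refine sum_congr rfl fun k _ => ?_
    congr 1
    omega

theorem sum_mul_colWeight (hp : p.parts.Nodup) :
    ∑ z ∈ diagram p, x * colWeight p x y z.2 = x * ∑ i ∈ Icc 1 (len p), rowWeight p x y i := by
  rw [← mul_sum, sum_diagram (fun _ j => colWeight p x y j)]
  congr 1
  exact sum_congr rfl fun i hi => sum_colWeight_row x y hp (mem_Icc.1 hi).1 (mem_Icc.1 hi).2

theorem rowWeight_one :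
    rowWeight p x y 1 = ((len p - 1 : ℕ) : R) * x + ∑ j ∈ Icc 1 (part p 1 + 1 - len p), y j := by
  rw [rowWeight, part_add_eq_rowEnd_succ le_rfl]

/-- For `r ≥ 2` the two hooks and `x` in the middle factor add up to `2 X 1`; the two factors with
index 1 of the first summand supply the rest. -/
theorem secondTerm_mul (hp : p.parts.Nodup) {r : ℕ} (h1 : 1 ≤ r) (h2 : r ≤ len p)
    (hr : IsCornerRow p r) :
    secondTerm p x y r (rowEnd p r) * ((rowWeight p x y 1 + rowWeight p x y r)
        * (rowWeight p x y 1 - rowWeight p x y r + x))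
      = firstTerm p x y r (rowEnd p r) * (2 * rowWeight p x y 1) := by
  have hc : ∀ i, 1 ≤ i → i ≤ r → _ := fun i hi hir => wHook_col_corner x y hp hi hir h2 hr
  rw [firstTerm, secondTerm, prod_Icc_eq_mul_prod_Icc_succ _ h1, hc 1 le_rfl h1]
  rcases h1.lt_or_eq with h | rfl
  · rw [if_pos (show 2 ≤ r from h), prod_Icc_eq_mul_prod_Icc_succ (a := 1) (b := r - 1) _ (by omega),
      wHook_col_pred x y hp le_rfl h h2]
    ring
  · rw [if_neg (by omega)]
    simp
    ring

/-- For `r ≥ 3` the bracket expands to `2 (X 1 * X 2 - X r * (X r - x))`. For `r = 1` the bound `max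
r 2` drops the factor `X 1 + X 2` of column 1. -/
theorem thirdTerm_mul (hp : p.parts.Nodup) {r : ℕ} (hlen : 2 ≤ len p) (h1 : 1 ≤ r)
    (h2 : r ≤ len p) (hr : IsCornerRow p r) :
    thirdTerm p x y r (rowEnd p r) * (((rowWeight p x y 1 + rowWeight p x y r)
        * (rowWeight p x y 1 - rowWeight p x y r + x))
        * ((rowWeight p x y 2 + rowWeight p x y r)
          * (rowWeight p x y 2 - rowWeight p x y r + x)))
      = firstTerm p x y r (rowEnd p r) * (2 * (rowWeight p x y 1 * rowWeight p x y 2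
          - rowWeight p x y r * (rowWeight p x y r - x))) := by
  have hc : ∀ i, 1 ≤ i → i ≤ r → _ := fun i hi hir => wHook_col_corner x y hp hi hir h2 hr
  rw [firstTerm, thirdTerm, prod_Icc_eq_mul_prod_Icc_succ _ h1, hc 1 le_rfl h1,
    max_eq_left hlen]
  rcases h1.lt_or_eq with h | rfl
  · rw [prod_Icc_eq_mul_prod_Icc_succ (a := 1 + 1) (b := r) _ h, hc _ (by omega) h,
      prod_Icc_eq_mul_prod_Icc_succ (a := 1) (b := r - 1) _ (by omega),
      wHook_col_pred x y hp le_rfl h h2, max_eq_left h]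
    rcases Nat.lt_or_eq_of_le h with h' | rfl
    · rw [if_pos (show 3 ≤ r from h'), prod_Icc_eq_mul_prod_Icc_succ (a := 1 + 1) (b := r - 1) _ (by omega),
        wHook_col_pred x y hp (by omega) h' h2]
      simp only [Nat.reduceAdd, Nat.succ_eq_add_one]
      ring
    · simp
      ring
  · rw [if_neg (by omega), if_neg (by omega),
      prod_Icc_eq_mul_prod_Icc_succ (a := 1) (b := len p - 1) _ (by omega),
      wHook_of_lt x y hp le_rfl le_rfl hlen]
    simp
    ring

/-- The factors dropped from the first summand are the corner factor `x` and the factor of column 1,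
which is `X 1`. -/
theorem thirdTerm_mul_of_len_eq_one (hp : p.parts.Nodup) (hlen : len p = 1) :
    thirdTerm p x y 1 (rowEnd p 1) * (x * rowWeight p x y 1)
      = firstTerm p x y 1 (rowEnd p 1) := by
  have hle := len_le_rowEnd hp le_rfl hlen.ge
  have hr : IsCornerRow p 1 := fun h => by omega
  have hz := colValue_sub_first x y hp (by omega)
  rw [firstTerm, thirdTerm, hlen, prod_Icc_eq_mul_prod_Icc_succ (a := 1) (b := rowEnd p 1) _
    (hlen ▸ hle), prod_Icc_eq_mul_prod_Icc_succ (a := 1) (b := 1) _ le_rfl,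
    wHook_col_corner x y hp le_rfl le_rfl hlen.ge hr,
    wHook_of_le x y (mem_diagram.2 ⟨le_rfl, hlen.ge, le_rfl, hlen ▸ hle⟩) hlen.le]
  rw [hlen] at hz
  simp
  simp at hz
  rw [sub_eq_zero.1 hz]
  ring

end Ring

/-! ### The identities at positive reals. -/

section Real

variable {x : ℝ} {y : ℕ → ℝ}

theorem rowWeight_pos (hp : p.parts.Nodup) (hx : 0 < x) (hy : ∀ t, 0 < y t) :
    ∀ i ∈ Icc 1 (len p), 0 < rowWeight p x y i := by
  intro i hi
  rw [mem_Icc] at hi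
  have hlen := len_le_rowEnd hp hi.1 hi.2
  refine add_pos_of_nonneg_of_pos (by positivity) (sum_pos (fun t _ => hy t) ?_)
  exact nonempty_Icc.2 (by omega)

theorem rowWeight_add_le (hp : p.parts.Nodup) (hx : 0 < x) (hy : ∀ t, 0 < y t) :
    ∀ i ∈ Icc 1 (len p), ∀ k ∈ Icc 1 (len p), i < k →
      rowWeight p x y k + x ≤ rowWeight p x y i := by
  intro i hi k hk hik
  rw [mem_Icc] at hi hk
  have hs : ∑ t ∈ Icc 1 (rowEnd p k + 1 - len p), y t ≤ ∑ t ∈ Icc 1 (rowEnd p i + 1 - len p), y t :=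
    sum_le_sum_of_subset_of_nonneg (Icc_subset_Icc_right (by
      have := rowEnd_anti hp hi.1 hik.le hk.2
      omega)) fun t _ _ => (hy t).le
  have hc : ((len p - k : ℕ) : ℝ) + 1 ≤ ((len p - i : ℕ) : ℝ) := by
    exact_mod_cast (show len p - k + 1 ≤ len p - i by omega)
  have := mul_le_mul_of_nonneg_right hc hx.le
  unfold rowWeight
  linarith

theorem wHook_pos (hp : p.parts.Nodup) (hx : 0 < x) (hy : ∀ t, 0 < y t) {i j : ℕ}
    (h : (i, j) ∈ diagram p) (hc : (i, j) ∉ corners p) : 0 < wHook p x y i j := by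
  obtain ⟨h1, h2, h3, h4⟩ := mem_diagram.1 h
  rcases lt_or_ge j (len p) with hj | hj
  · rw [wHook_of_lt x y hp h1 h3 hj]
    have := rowWeight_add_le hp hx hy i (mem_Icc.2 ⟨h1, h2⟩) (j + 1)
      (mem_Icc.2 ⟨by omega, hj⟩) (by omega)
    have := rowWeight_pos hp hx hy (j + 1) (mem_Icc.2 ⟨by omega, hj⟩)
    linarith
  · have e1 := part_add_eq_rowEnd_succ (p := p) h1
    rw [wHook, if_neg (by omega)]
    rcases h4.lt_or_eq with hlt | rfl
    · refine add_pos_of_nonneg_of_pos (by positivity) (sum_pos (fun t _ => hy t) ?_)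
      exact nonempty_Icc.2 (by omega)
    -- At a row end the `y`-sum is empty; positivity comes from the coefficient of `x`, as row `i +
    -- 1` also reaches this column.
    · have hnc : ¬ IsCornerRow p i := fun hr => hc ((mem_corners hp).2 ⟨⟨h1, h2⟩, rfl, hr⟩)
      obtain ⟨hlt, he⟩ := not_isCornerRow hp h1 hnc
      have hl := le_lastRow (p := p) (i := i + 1) (j := rowEnd p i) (by omega) hlt (by omega) he.ge
      have : (0 : ℝ) < ((lastRow p (rowEnd p i) - i : ℕ) : ℝ) := by
        exact_mod_cast (show 0 < lastRow p (rowEnd p i) - i by omega)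
      exact add_pos_of_pos_of_nonneg (mul_pos this hx) (sum_nonneg fun t _ => (hy t).le)

theorem hookProd_pos (hp : p.parts.Nodup) (hx : 0 < x) (hy : ∀ t, 0 < y t) :
    0 < hookProd p x y := by
  refine prod_pos fun z hz => ?_
  rw [mem_sdiff] at hz
  exact wHook_pos hp hx hy hz.1 hz.2

/-- After `restProd` cancels, `prod_col_corner` at `v = X r` turns the quotient of the column
products into `X r ∏_{i > r} (X r - X i - x) / (X r - X i)`. The remaining factors pair up through
`w_r - a_i = -(X i + X r) (X i - X r + x)` and `w_r - w_i = (X r - X i) (X r + X i - x)`. -/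
theorem firstTerm_eq_mul_rowCoeff (hp : p.parts.Nodup) (hx : 0 < x) (hy : ∀ t, 0 < y t) {r : ℕ}
    (h1 : 1 ≤ r) (h2 : r ≤ len p) (hr : IsCornerRow p r) :
    firstTerm p x y r (rowEnd p r)
      = hookProd p x y * rowCoeff (len p) x (rowWeight p x y) r := by
  have hP := hookProd_eq x y hp h1 h2 hr
  have hne := (hookProd_pos hp hx hy).ne'
  have hcol := prod_col_corner x y hp (rowWeight p x y r) h1 h2 hr
  have hb : ∏ i ∈ Ioc r (len p), (rowWeight p x y r - rowWeight p x y i) ≠ 0 := by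
    refine prod_ne_zero_iff.2 fun i hi => ?_
    rw [mem_Ioc] at hi
    have := rowWeight_add_le hp hx hy r (mem_Icc.2 ⟨h1, h2⟩) i (mem_Icc.2 ⟨by omega, hi.2⟩) hi.1
    exact ne_of_gt (by linarith)
  have hsplit : (Icc 1 (len p)).erase r = Ico 1 r ∪ Ioc r (len p) := by
    ext i
    simp only [mem_erase, mem_Icc, mem_union, mem_Ico, mem_Ioc]
    omega
  have hdisj : Disjoint (Ico 1 r) (Ioc r (len p)) := by
    simp only [disjoint_left, mem_Ico, mem_Ioc]
    intros
    omega
  have e1 : ∀ i, (rowWeight p x y r * (rowWeight p x y r - x)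
        - rowWeight p x y i * (rowWeight p x y i + x))
        / (rowWeight p x y r * (rowWeight p x y r - x)
          - rowWeight p x y i * (rowWeight p x y i - x))
      = ((rowWeight p x y i - rowWeight p x y r + x) / (rowWeight p x y i - rowWeight p x y r))
        * ((rowWeight p x y i + rowWeight p x y r)
          / (rowWeight p x y i + rowWeight p x y r - x)) := by
    intro i
    rw [div_mul_div_comm, ← neg_div_neg_eq]
    congr 1 <;> ring
  have e2 : ∀ i, (rowWeight p x y r * (rowWeight p x y r - x)
        - rowWeight p x y i * (rowWeight p x y i + x))
        / (rowWeight p x y r * (rowWeight p x y r - x)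
          - rowWeight p x y i * (rowWeight p x y i - x))
      = ((rowWeight p x y r - rowWeight p x y i - x) / (rowWeight p x y r - rowWeight p x y i))
        * ((rowWeight p x y r + rowWeight p x y i)
          / (rowWeight p x y r + rowWeight p x y i - x)) := by
    intro i
    rw [div_mul_div_comm]
    congr 1 <;> ring
  rw [rowCoeff, hsplit, prod_union hdisj, prod_congr rfl fun i _ => e1 i,
    prod_congr (s₁ := Ioc r (len p)) rfl fun i _ => e2 i]
  simp only [prod_mul_distrib, prod_div_distrib]
  rw [firstTerm_eq x y hp h1 h2 hr]
  rw [hP] at hne ⊢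
  simp only [mul_ne_zero_iff] at hne
  obtain ⟨-, ⟨⟨n1, -⟩, n3⟩, n4⟩ := hne
  field_simp
  linear_combination restProd p x y r (rowEnd p r) *
    (∏ i ∈ Ico 1 r, (rowWeight p x y i - rowWeight p x y r + x)) *
    (∏ i ∈ Ioc r (len p), (rowWeight p x y r + rowWeight p x y i)) *
    (∏ i ∈ Ico 1 r, (rowWeight p x y i + rowWeight p x y r)) * hcol

theorem rowCoeff_eq_zero_of_not_isCornerRow (hp : p.parts.Nodup) {r : ℕ} (h1 : 1 ≤ r)
    (hr : ¬ IsCornerRow p r) : rowCoeff (len p) x (rowWeight p x y) r = 0 := by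
  obtain ⟨hlt, he⟩ := not_isCornerRow hp h1 hr
  exact rowCoeff_eq_zero (mem_Icc.2 ⟨by omega, hlt⟩) (Nat.succ_ne_self r)
    (rowWeight_succ_of_eq x y hlt he)

theorem sum_corners_eq_of_eq_mul_rowCoeff (hp : p.parts.Nodup) (T : ℕ → ℕ → ℝ) (g : ℕ → ℝ)
    (h : ∀ r, 1 ≤ r → r ≤ len p → IsCornerRow p r →
      T r (rowEnd p r) = g r * rowCoeff (len p) x (rowWeight p x y) r) :
    ∑ c ∈ corners p, T c.1 c.2
      = ∑ r ∈ Icc 1 (len p), g r * rowCoeff (len p) x (rowWeight p x y) r := by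
  rw [sum_corners hp]
  refine sum_congr rfl fun r hr => ?_
  rw [mem_Icc] at hr
  split_ifs with hc
  · exact h r hr.1 hr.2 hc
  · rw [rowCoeff_eq_zero_of_not_isCornerRow hp hr.1 hc, mul_zero]

theorem sum_firstTerm_of_pos (hp : p.parts.Nodup) (hx : 0 < x) (hy : ∀ t, 0 < y t) :
    (∑ z ∈ diagram p, x * colWeight p x y z.2) * hookProd p x y
      = ∑ c ∈ corners p, firstTerm p x y c.1 c.2 := by
  rw [sum_corners_eq_of_eq_mul_rowCoeff hp _ (fun _ => hookProd p x y)
      (fun r h1 h2 hr => firstTerm_eq_mul_rowCoeff hp hx hy h1 h2 hr),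
    sum_mul_colWeight x y hp,
    ← sum_rowCoeff_eq hx (rowWeight_pos hp hx hy) (rowWeight_add_le hp hx hy),
    ← mul_sum, mul_comm]

theorem sum_secondTerm_of_pos (hp : p.parts.Nodup) (hl : 1 ≤ len p) (hx : 0 < x)
    (hy : ∀ t, 0 < y t) :
    rowWeight p x y 1 * hookProd p x y = ∑ c ∈ corners p, secondTerm p x y c.1 c.2 := by
  have hpos := rowWeight_pos hp hx hy
  have hgap := rowWeight_add_le hp hx hy
  have m1 : 1 ∈ Icc 1 (len p) := mem_Icc.2 ⟨le_rfl, hl⟩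
  rw [sum_corners_eq_of_eq_mul_rowCoeff hp _ (fun r => hookProd p x y * rowWeight p x y 1
      * (2 / (rowWeight p x y 1 * (rowWeight p x y 1 + x)
        - rowWeight p x y r * (rowWeight p x y r - x)))) ?_]
  · rw [← mul_one (rowWeight p x y 1 * hookProd p x y),
      ← sum_rowCoeff_div_first hl hx hpos hgap, mul_sum]
    exact sum_congr rfl fun r _ => by ring
  · intro r h1 h2 hr
    have d := sub_pos_of_le hx hpos hgap m1 (mem_Icc.2 ⟨h1, h2⟩) h1
    have e := secondTerm_mul x y hp h1 h2 hr
    rw [firstTerm_eq_mul_rowCoeff hp hx hy h1 h2 hr] at e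
    rw [← mul_left_inj' d.ne']
    field_simp
    linear_combination e

theorem sum_thirdTerm_of_pos (hp : p.parts.Nodup) (hl : 1 ≤ len p) (hx : 0 < x)
    (hy : ∀ t, 0 < y t) :
    hookProd p x y = ∑ c ∈ corners p, thirdTerm p x y c.1 c.2 := by
  have hpos := rowWeight_pos hp hx hy
  have hgap := rowWeight_add_le hp hx hy
  have m1 : 1 ∈ Icc 1 (len p) := mem_Icc.2 ⟨le_rfl, hl⟩
  have p1 := hpos 1 m1
  rcases hl.lt_or_eq with hl2 | hl1
  · have m2 : 2 ∈ Icc 1 (len p) := mem_Icc.2 ⟨by omega, hl2⟩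
    rw [sum_corners_eq_of_eq_mul_rowCoeff hp _ (fun r => hookProd p x y
      * (2 * (rowWeight p x y 1 * rowWeight p x y 2 - rowWeight p x y r * (rowWeight p x y r - x))
        / ((rowWeight p x y 1 * (rowWeight p x y 1 + x)
          - rowWeight p x y r * (rowWeight p x y r - x))
        * (rowWeight p x y 2 * (rowWeight p x y 2 + x)
          - rowWeight p x y r * (rowWeight p x y r - x))))) ?_]
    · refine (mul_one _).symm.trans ?_
      rw [← sum_rowCoeff_div_first_second hl2 hx hpos hgap, mul_sum]
      exact sum_congr rfl fun r _ => by ring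
    · intro r h1 h2 hr
      have d1 := (sub_pos_of_le hx hpos hgap m1 (mem_Icc.2 ⟨h1, h2⟩) h1).ne'
      have d2 : rowWeight p x y 2 * (rowWeight p x y 2 + x)
          - rowWeight p x y r * (rowWeight p x y r - x) ≠ 0 := by
        rcases h1.lt_or_eq with h | rfl
        · exact (sub_pos_of_le hx hpos hgap m2 (mem_Icc.2 ⟨h1, h2⟩) h).ne'
        -- For `r = 1` the denominator is negative: row 1 has a corner, so row 2 ends strictly
        -- earlier and `X 2 + x < X 1`.
        · have p2 := hpos 2 m2
          have hne : rowWeight p x y 2 + x < rowWeight p x y 1 := by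
            have hs : ∑ t ∈ Icc 1 (rowEnd p 2 + 1 - len p), y t
                < ∑ t ∈ Icc 1 (rowEnd p 1 + 1 - len p), y t := by
              have h3 : rowEnd p 2 < rowEnd p 1 := hr hl2
              have h4 := len_le_rowEnd hp (i := 2) (by omega) hl2
              refine sum_lt_sum_of_subset (i := rowEnd p 1 + 1 - len p)
                (Icc_subset_Icc_right (by omega)) (mem_Icc.2 ⟨by omega, le_rfl⟩) ?_ (hy _)
                (fun t _ _ => (hy t).le)
              rw [mem_Icc]
              omega
            have hc : ((len p - 2 : ℕ) : ℝ) + 1 = ((len p - 1 : ℕ) : ℝ) := by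
              exact_mod_cast (show len p - 2 + 1 = len p - 1 by omega)
            unfold rowWeight
            rw [← hc]
            linarith
          have : (rowWeight p x y 2 + rowWeight p x y 1)
              * (rowWeight p x y 2 - rowWeight p x y 1 + x) < 0 :=
            mul_neg_of_pos_of_neg (by linarith) (by linarith)
          refine ne_of_lt ?_
          linarith
      have e := thirdTerm_mul x y hp hl2 h1 h2 hr
      rw [firstTerm_eq_mul_rowCoeff hp hx hy h1 h2 hr] at e
      rw [← mul_left_inj' (mul_ne_zero d1 d2)]
      field_simp
      linear_combination e
  -- With a single part there is one corner, and the first identity divided by `x * X 1` is the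
  -- third.
  · have h := sum_firstTerm_of_pos hp hx hy
    have hr : IsCornerRow p 1 := fun h => by omega
    rw [sum_mul_colWeight x y hp, sum_corners hp, ← hl1, Icc_self, sum_singleton, sum_singleton,
      if_pos hr, ← thirdTerm_mul_of_len_eq_one x y hp hl1.symm] at h
    rw [sum_corners hp, ← hl1, Icc_self, sum_singleton, if_pos hr]
    have hne : x * rowWeight p x y 1 ≠ 0 := (mul_pos hx p1).ne'
    refine mul_left_cancel₀ hne ?_
    linear_combination h

end Real

end ShiftedDiagram

/-! ### Transfer from positive reals to commutative rings. -/

namespace ShiftedDiagram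

variable {n : ℕ} {p : Nat.Partition n}

section Map

variable {R S : Type*} [CommRing R] [CommRing S] (f : R →+* S) (x : R) (y : ℕ → R)

theorem map_wHook (i j : ℕ) :
    f (wHook p x y i j) = wHook p (f x) (fun t => f (y t)) i j := by
  unfold wHook
  split_ifs <;> simp [map_ofNat]

theorem map_hookProd : f (hookProd p x y) = hookProd p (f x) (fun t => f (y t)) := by
  simp only [hookProd, map_prod, map_wHook]

theorem map_restProd (r s : ℕ) :
    f (restProd p x y r s) = restProd p (f x) (fun t => f (y t)) r s := by
  simp only [restProd, map_prod, map_wHook]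

theorem map_colWeight (q : ℕ) :
    f (colWeight p x y q) = colWeight p (f x) (fun t => f (y t)) q := by
  unfold colWeight
  split_ifs <;> rfl

theorem map_rowWeight (i : ℕ) :
    f (rowWeight p x y i) = rowWeight p (f x) (fun t => f (y t)) i := by
  simp [rowWeight]

theorem map_firstTerm (r s : ℕ) :
    f (firstTerm p x y r s) = firstTerm p (f x) (fun t => f (y t)) r s := by
  simp only [firstTerm, map_mul, map_add, map_prod, map_restProd, map_wHook]

theorem map_secondTerm (r s : ℕ) :
    f (secondTerm p x y r s) = secondTerm p (f x) (fun t => f (y t)) r s := by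
  unfold secondTerm
  split_ifs <;> simp only [map_mul, map_add, map_prod, map_restProd, map_wHook, map_one]

theorem map_thirdTerm (r s : ℕ) :
    f (thirdTerm p x y r s) = thirdTerm p (f x) (fun t => f (y t)) r s := by
  unfold thirdTerm
  split_ifs <;> simp only [map_mul, map_add, map_prod, map_restProd, map_wHook, map_one]

end Map

/-- Integer polynomials that agree at all points with positive real coordinates are equal. -/
theorem _root_.MvPolynomial.eq_of_forall_pos_eval₂ {σ : Type*} {P Q : MvPolynomial σ ℤ}
    (h : ∀ a : σ → ℝ, (∀ i, 0 < a i) →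
      MvPolynomial.eval₂Hom (Int.castRingHom ℝ) a P = MvPolynomial.eval₂Hom (Int.castRingHom ℝ) a Q) :
    P = Q := by
  apply MvPolynomial.map_injective (Int.castRingHom ℝ) Int.cast_injective
  refine MvPolynomial.funext_set (fun _ => Set.Ioi 0) (fun _ => Set.Ioi_infinite 0) fun a ha => ?_
  rw [MvPolynomial.eval_map, MvPolynomial.eval_map]
  exact h a fun i => ha i (Set.mem_univ i)

section Transfer

variable {R : Type*} [CommRing R] (x : R) (y : ℕ → R)

/-- An identity between two expressions that are compatible with ring homomorphisms from
`ℤ[x, y₀, y₁, …]` holds in every commutative ring if it holds at all positive reals. -/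
theorem eq_of_forall_pos
    (F G : ∀ {S : Type} [CommRing S], S → (ℕ → S) → S) (a b : R)
    (hF : ∀ g : MvPolynomial (Option ℕ) ℤ →+* ℝ, ∀ u v, g (F u v) = F (g u) fun t => g (v t))
    (hG : ∀ g : MvPolynomial (Option ℕ) ℤ →+* ℝ, ∀ u v, g (G u v) = G (g u) fun t => g (v t))
    (ha : MvPolynomial.eval₂Hom (Int.castRingHom R) (fun o => Option.elim o x y)
      (F (MvPolynomial.X none) fun t => MvPolynomial.X (some t)) = a)
    (hb : MvPolynomial.eval₂Hom (Int.castRingHom R) (fun o => Option.elim o x y)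
      (G (MvPolynomial.X none) fun t => MvPolynomial.X (some t)) = b)
    (h : ∀ (u : ℝ) (v : ℕ → ℝ), 0 < u → (∀ t, 0 < v t) → F u v = G u v) : a = b := by
  rw [← ha, ← hb]
  congr 1
  refine MvPolynomial.eq_of_forall_pos_eval₂ fun c hc => ?_
  rw [hF, hG]
  simp only [MvPolynomial.eval₂Hom_X']
  exact h _ _ (hc _) fun t => hc _

theorem sum_firstTerm (hp : p.parts.Nodup) :
    (∑ z ∈ diagram p, x * colWeight p x y z.2) * hookProd p x y
      = ∑ c ∈ corners p, firstTerm p x y c.1 c.2 := by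
  refine eq_of_forall_pos x y
    (fun {S} _ u v => (∑ z ∈ diagram p, u * colWeight p u v z.2) * hookProd p u v)
    (fun {S} _ u v => ∑ c ∈ corners p, firstTerm p u v c.1 c.2) _ _ ?_ ?_ ?_ ?_
    (fun u v hu hv => sum_firstTerm_of_pos hp hu hv)
  all_goals
    intros
    simp only [map_mul, map_sum, map_colWeight, map_hookProd, map_firstTerm,
      MvPolynomial.eval₂Hom_X', Option.elim]

theorem sum_secondTerm (hp : p.parts.Nodup) (hl : 1 ≤ len p) :
    rowWeight p x y 1 * hookProd p x y = ∑ c ∈ corners p, secondTerm p x y c.1 c.2 := by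
  refine eq_of_forall_pos x y
    (fun {S} _ u v => rowWeight p u v 1 * hookProd p u v)
    (fun {S} _ u v => ∑ c ∈ corners p, secondTerm p u v c.1 c.2) _ _ ?_ ?_ ?_ ?_
    (fun u v hu hv => sum_secondTerm_of_pos hp hl hu hv)
  all_goals
    intros
    simp only [map_mul, map_sum, map_rowWeight, map_hookProd, map_secondTerm,
      MvPolynomial.eval₂Hom_X', Option.elim]

theorem sum_thirdTerm (hp : p.parts.Nodup) (hl : 1 ≤ len p) :
    hookProd p x y = ∑ c ∈ corners p, thirdTerm p x y c.1 c.2 := by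
  refine eq_of_forall_pos x y
    (fun {S} _ u v => hookProd p u v)
    (fun {S} _ u v => ∑ c ∈ corners p, thirdTerm p u v c.1 c.2) _ _ ?_ ?_ ?_ ?_
    (fun u v hu hv => sum_thirdTerm_of_pos hp hl hu hv)
  all_goals
    intros
    simp only [map_sum, map_hookProd, map_thirdTerm,
      MvPolynomial.eval₂Hom_X', Option.elim]

end Transfer

theorem one_le_len (hn : 0 < n) (p : Nat.Partition n) : 1 ≤ len p := by
  rw [len, Nat.one_le_iff_ne_zero, Multiset.card_eq_zero.ne]
  intro h
  have := p.parts_sum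
  rw [h, Multiset.sum_zero] at this
  omega

end ShiftedDiagram

theorem mainTheorem4 {R : Type*} [CommRing R] (x : R) (y : ℕ → R)
    {n : ℕ} (hn : 0 < n) (p : Nat.Partition n) (hp : p.parts.Nodup) :
    ((∑ z ∈ ShiftedDiagram.diagram p, x * ShiftedDiagram.colWeight p x y z.2)
          * ShiftedDiagram.hookProd p x y
        = ∑ c ∈ ShiftedDiagram.corners p,
            ShiftedDiagram.restProd p x y c.1 c.2
            * (∏ i ∈ Finset.Icc 1 c.1, (ShiftedDiagram.wHook p x y i c.2 + x))
            * (∏ j ∈ Finset.Icc c.1 (ShiftedDiagram.len p - 1),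
                (ShiftedDiagram.wHook p x y c.1 j + x))
            * (∏ j ∈ Finset.Icc (ShiftedDiagram.len p) c.2,
                (ShiftedDiagram.wHook p x y c.1 j + y (j + 1 - ShiftedDiagram.len p)))
            * (∏ i ∈ Finset.Icc 1 (c.1 - 1), (ShiftedDiagram.wHook p x y i (c.1 - 1) + x)))
    ∧ ((((ShiftedDiagram.len p - 1 : ℕ) : R) * x
            + ∑ j ∈ Finset.Icc 1 (ShiftedDiagram.part p 1 + 1 - ShiftedDiagram.len p), y j)
          * ShiftedDiagram.hookProd p x y
        = ∑ c ∈ ShiftedDiagram.corners p,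
            ShiftedDiagram.restProd p x y c.1 c.2
            * (if 2 ≤ c.1 then
                ShiftedDiagram.wHook p x y 1 (c.1 - 1) + ShiftedDiagram.wHook p x y 1 c.2 + x
              else 1)
            * (∏ i ∈ Finset.Icc 2 c.1, (ShiftedDiagram.wHook p x y i c.2 + x))
            * (∏ j ∈ Finset.Icc c.1 (ShiftedDiagram.len p - 1),
                (ShiftedDiagram.wHook p x y c.1 j + x))
            * (∏ j ∈ Finset.Icc (ShiftedDiagram.len p) c.2,
                (ShiftedDiagram.wHook p x y c.1 j + y (j + 1 - ShiftedDiagram.len p)))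
            * (∏ i ∈ Finset.Icc 2 (c.1 - 1), (ShiftedDiagram.wHook p x y i (c.1 - 1) + x)))
    ∧ (ShiftedDiagram.hookProd p x y
        = ∑ c ∈ ShiftedDiagram.corners p,
            ShiftedDiagram.restProd p x y c.1 c.2
            * (if 3 ≤ c.1 then
                (ShiftedDiagram.wHook p x y 1 c.2 + x)
                    * (ShiftedDiagram.wHook p x y 2 (c.1 - 1) + x)
                  + ShiftedDiagram.wHook p x y 1 (c.1 - 1) * ShiftedDiagram.wHook p x y 2 c.2
              else if c.1 = 2 then ShiftedDiagram.wHook p x y 1 c.2 + x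
              else 1)
            * (∏ i ∈ Finset.Icc 3 c.1, (ShiftedDiagram.wHook p x y i c.2 + x))
            * (∏ j ∈ Finset.Icc (max c.1 2) (ShiftedDiagram.len p - 1),
                (ShiftedDiagram.wHook p x y c.1 j + x))
            * (∏ j ∈ Finset.Icc (max (ShiftedDiagram.len p) 2) c.2,
                (ShiftedDiagram.wHook p x y c.1 j + y (j + 1 - ShiftedDiagram.len p)))
            * (∏ i ∈ Finset.Icc 3 (c.1 - 1),
                (ShiftedDiagram.wHook p x y i (c.1 - 1) + x))) := by
  have hl := ShiftedDiagram.one_le_len hn p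
  refine ⟨ShiftedDiagram.sum_firstTerm x y hp, ?_, ShiftedDiagram.sum_thirdTerm x y hp hl⟩
  rw [← ShiftedDiagram.rowWeight_one]
  exact ShiftedDiagram.sum_secondTerm x y hp hl
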